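/- All Hilbert spaces are finite-dimensional and non-zero. **Networks.** A (possibly cyclic) quantum network $\mathfrak N$ consists of finitely many completely positive maps with named input and output systems and of a set of compositions, each identifying one output system with one input system of the same dimension, every input and output being used in at most one composition; $\mathfrak N^{\mathrm{sys}}$ is the set of systems after this identification. A sub-network is a subset of the maps with a subset of the compositions between them. Its induced map, from its uncomposed inputs to its uncomposed outputs, is obtained from the tensor product of its maps by loop composition $\mathcal M\mapsto\big(\rho\mapsto\sum_{i,j}\langle i|\mathcal M(\rho\otimes|i\rangle\langle j|)|j\rangle\big)$ of each composed pair. For a completely positive map $\mathcal M$, a set $S_I$ of inputs signals to a set $S_O$ of outputs if there is a channel (completely positive trace-preserving map) $\mathcal C$ on $S_I$ with $\mathrm{Tr}_{\mathrm{Out}\setminus S_O}\circ\mathcal M\neq\mathrm{Tr}_{\mathrm{Out}\setminus S_O}\circ\mathcal M\circ\mathcal C$. In a network, $S_1\subseteq\mathfrak N^{\mathrm{sys}}$ signals to $S_2\subseteq\mathfrak N^{\mathrm{sys}}$ if it does so in the induced map of some sub-network. The signalling structure is compatible with a directed graph $G$ under an assignment $\mathcal E$ of nodes of $G$ to systems if,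 whenever $S_1$ signals to $S_2$ and $S_1\cap S_2=\emptyset$, there is a directed path with at least one edge from $\mathcal E(s_1)$ to $\mathcal E(s_2)$ for some $s_1\in S_1$, $s_2\in S_2$. **Fine-graining.** A map $\mathcal M^f$ is a fine-graining of $\mathcal M$ with respect to $\mathcal F$, which sends each input (output) of $\mathcal M$ to a set of inputs (outputs) of $\mathcal M^f$, if $\mathcal M=\mathrm{Dec}\circ\mathcal M^f\circ\mathrm{Enc}$ for a channel $\mathrm{Enc}$ and a linear map $\mathrm{Dec}$ that is completely positive and trace-preserving on the image of $\mathcal M^f\circ\mathrm{Enc}$, and if $S_I$ signalling to $S_O$ in $\mathcal M$ implies that $\bigcup_{s\in S_I}\mathcal F(s)$ signals to $\bigcup_{s\in S_O}\mathcal F(s)$ in $\mathcal M^f$. A network $\mathfrak N^f$ is a fine-graining of $\mathfrak N$ with respect to $\mathcal F$, which sends distinct systems of $\mathfrak N$ to disjoint sets of systems of $\mathfrak N^f$, if for every sub-network of $\mathfrak N$ there is a sub-network of $\mathfrak N^f$ whose induced map is a fine-graining of the induced map of the former. **Spacetime realisations.** Let $(\mathcal T,\prec)$ be a partially ordered set,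 with $\prec$ its strict order. The region causal structure on a set of regions (subsets of $\mathcal T$) is the directed graph with an edge $\mathcal R_1\to\mathcal R_2$ (loops allowed) iff $R_1\prec R_2$ for some $R_1\in\mathcal R_1$, $R_2\in\mathcal R_2$; it is acyclic if it has no directed cycle, a loop being a cycle. A spacetime realisation of $\mathfrak N$ in $\mathcal T$ consists of an embedding $\mathcal E$ assigning a region to every system of $\mathfrak N$, a fine-graining $\mathfrak N^f$ of $\mathfrak N$ with respect to some $\mathcal F$, and an embedding $\mathcal E^f$ of the systems of $\mathfrak N^f$, such that each $\mathcal E(S)$ is the disjoint union of the regions $\mathcal E^f(s)$, $s\in\mathcal F(S)$, every system of $\mathfrak N^f$ is embedded in one of the regions of these partitions, and the region causal structure on these regions is acyclic. It satisfies relativistic causality if the signalling structure of $\mathfrak N^f$ is compatible with that fine-grained region causal structure under $\mathcal E^f$. **Processes.** An $N$-party process matrix $W$, for parties $A_i$ with input $A_i^I$ and output $A_i^O$, is a positive operator on $\bigotimes_i A_i^I\otimes A_i^O$ with $\mathrm{Tr}\big(\bigotimes_i M_i\,W\big)=1$ for the Choi matrices $M_i$ of all local channels $A_i^I\to A_i^O$.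 It is a fixed order process if there is a strict partial order on the parties such that, for all local quantum instruments (one for every setting of each party), with outcome probabilities $P(x|a)=\mathrm{Tr}\big(\bigotimes_i M^{i}_{x_i|a_i}\,W\big)$, the joint distribution of the outcomes of every set $K$ of parties depends only on the settings of the parties in $K$ and of those that precede some party in $K$. The process network $\mathfrak N_{W,N}$ is formed by the map $\mathcal W$ from all $A_i^O$ to all $A_i^I$ with Choi matrix $W$, composed through all the $A_i^I$ and $A_i^O$ with local operations of the parties, channels from $A_i^I$ and a setting system to $A_i^O$ and an outcome system. Since the agents may choose any local operation between $A_i^I$ and $A_i^O$, it is understood that, for each $i$ for which $A_i^I$ and $A_i^O$ both have dimension at least two, the settings allow $\{A_i^I\}$ to signal to $\{A_i^O\}$ in the local operation of $A_i$. **Theorem 1.** For any $N$-party process matrix $W$, no spacetime realisation of the process network $\mathfrak N_{W,N}$ in a partially ordered spacetime, with embedding $\mathcal E$, can satisfy all of the following: 1. $W$ is not a fixed order process; 2. the realisation satisfies relativistic causality; 3. the region causal structure on the image of $\mathcal E$ is acyclic. -/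

import Mathlib

open Matrix
open scoped ComplexOrder

noncomputable section

namespace QST

/-! ## Completely positive maps -/

/-- Linear maps from operators on `ℂ^X` to operators on `ℂ^Y`. -/
abbrev OpMap (X Y : Type) : Type := Matrix X X ℂ →ₗ[ℂ] Matrix Y Y ℂ

/-- The action of `Φ ⊗ id` on operators on `ℂ^X ⊗ ℂ^n`. -/
def amplify {X Y : Type} (Φ : OpMap X Y) (n : ℕ) (ρ : Matrix (X × Fin n) (X × Fin n) ℂ) :
    Matrix (Y × Fin n) (Y × Fin n) ℂ :=
  Matrix.of fun p q => Φ (Matrix.of fun x x' => ρ (x, p.2) (x', q.2)) p.1 q.1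

/-- Complete positivity. -/
def IsCP {X Y : Type} (Φ : OpMap X Y) : Prop :=
  ∀ (n : ℕ) (ρ : Matrix (X × Fin n) (X × Fin n) ℂ), ρ.PosSemidef → (amplify Φ n ρ).PosSemidef

/-- Trace preservation. -/
def IsTP {X Y : Type} [Fintype X] [Fintype Y] (Φ : OpMap X Y) : Prop :=
  ∀ ρ : Matrix X X ℂ, (Φ ρ).trace = ρ.trace

/-- Completely positive and trace preserving maps (quantum channels). -/
def IsCPTP {X Y : Type} [Fintype X] [Fintype Y] (Φ : OpMap X Y) : Prop :=
  IsCP Φ ∧ IsTP Φ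

/-- Complete positivity and trace preservation on a subspace `V` of operators: `Φ ⊗ id` maps the
positive elements of `V ⊗ L(ℂ^n)` to positive operators, and `Φ` preserves the trace on `V`. -/
def IsCPTPOn {X Y : Type} [Fintype X] [Fintype Y] (V : Submodule ℂ (Matrix X X ℂ))
    (Φ : OpMap X Y) : Prop :=
  (∀ (n : ℕ) (ρ : Matrix (X × Fin n) (X × Fin n) ℂ),
    (∀ a b : Fin n, (Matrix.of fun x x' => ρ (x, a) (x', b)) ∈ V) →
      ρ.PosSemidef → (amplify Φ n ρ).PosSemidef) ∧
  ∀ ρ ∈ V, (Φ ρ).trace = ρ.trace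

/-! ## Maps between sets of systems -/

section Systems

variable {Sys : Type} [DecidableEq Sys]

/-- The computational basis of the joint Hilbert space of the set `A` of systems, the system `s`
having dimension `d s`. -/
abbrev Idx (d : Sys → ℕ) (A : Finset Sys) : Type := ∀ s : A, Fin (d s)

/-- Linear maps from operators on the joint system `A` to operators on the joint system `B`. -/
abbrev SysMap (d : Sys → ℕ) (A B : Finset Sys) : Type := OpMap (Idx d A) (Idx d B)

/-- Restriction of a basis label to a subset of the systems. -/
def restrict {d : Sys → ℕ} {S A : Finset Sys} (h : S ⊆ A) (x : Idx d A) : Idx d S :=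
  fun s => x ⟨s.1, h s.2⟩

/-- The basis label that agrees with `u` on `S` and with `x` elsewhere. -/
def override {d : Sys → ℕ} {S A : Finset Sys} (u : Idx d S) (x : Idx d A) : Idx d A :=
  fun s => if h : s.1 ∈ S then u ⟨s.1, h⟩ else x s

/-- The basis label of `B` that is `y` on `S` and `z` on the remaining systems. -/
def glue {d : Sys → ℕ} {S B : Finset Sys} (y : Idx d S) (z : Idx d (B \ S)) : Idx d B :=
  fun s => if h : s.1 ∈ S then y ⟨s.1, h⟩ else z ⟨s.1, Finset.mem_sdiff.mpr ⟨s.2, h⟩⟩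

/-- The map `N ⊗ id` on operators on `A` that acts as `N` on the subset `S` of the systems. -/
def localise {d : Sys → ℕ} {S A : Finset Sys} (h : S ⊆ A) (N : SysMap d S S) : SysMap d A A where
  toFun ρ := Matrix.of fun x x' =>
    N (Matrix.of fun u u' => ρ (override u x) (override u' x')) (restrict h x) (restrict h x')
  map_add' ρ σ := by
    ext x x'
    have e : (Matrix.of fun u u' : Idx d S => (ρ + σ) (override u x) (override u' x')) =
        (Matrix.of fun u u' => ρ (override u x) (override u' x')) +
          Matrix.of fun u u' => σ (override u x) (override u' x') := rfl
    change N (Matrix.of fun u u' : Idx d S => (ρ + σ) (override u x) (override u' x')) _ _ = _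
    rw [e, map_add]
    rfl
  map_smul' c ρ := by
    ext x x'
    have e : (Matrix.of fun u u' : Idx d S => (c • ρ) (override u x) (override u' x')) =
        c • (Matrix.of fun u u' => ρ (override u x) (override u' x')) := rfl
    change N (Matrix.of fun u u' : Idx d S => (c • ρ) (override u x) (override u' x')) _ _ = _
    rw [e, map_smul]
    rfl

/-- The partial trace over the systems in `B \ S`. -/
def traceOut {d : Sys → ℕ} {S B : Finset Sys} (_h : S ⊆ B) : SysMap d B S where
  toFun σ := Matrix.of fun y y' => ∑ z : Idx d (B \ S), σ (glue y z) (glue y' z)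
  map_add' σ τ := by
    ext y y'
    simp [Finset.sum_add_distrib]
  map_smul' c σ := by
    ext y y'
    simp [Finset.mul_sum]

/-- The set `SI` of inputs of `M` signals to the set `SO` of outputs of `M`: some channel acting
locally on `SI` before `M` changes `M` after tracing out all outputs but `SO`. -/
def Signals {d : Sys → ℕ} {A B : Finset Sys} (M : SysMap d A B) (SI SO : Finset Sys) : Prop :=
  ∃ (hI : SI ⊆ A) (hO : SO ⊆ B) (N : SysMap d SI SI), IsCPTP N ∧
    traceOut hO ∘ₗ M ≠ traceOut hO ∘ₗ M ∘ₗ localise hI N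

/-- `Mf` is a fine-graining of `M` with respect to the map `F`, which sends every system of `M` to
a set of systems of `Mf`. -/
def IsFineGraining {Sysf : Type} [DecidableEq Sysf] {d : Sys → ℕ} {df : Sysf → ℕ}
    {A B : Finset Sys} {Af Bf : Finset Sysf} (F : Sys → Finset Sysf)
    (M : SysMap d A B) (Mf : SysMap df Af Bf) : Prop :=
  (∀ s ∈ A, F s ⊆ Af) ∧ (∀ s ∈ B, F s ⊆ Bf) ∧
  (∃ (Enc : OpMap (Idx d A) (Idx df Af)) (Dec : OpMap (Idx df Bf) (Idx d B)),
    IsCPTP Enc ∧ IsCPTPOn (LinearMap.range (Mf ∘ₗ Enc)) Dec ∧ M = Dec ∘ₗ Mf ∘ₗ Enc) ∧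
  ∀ SI SO : Finset Sys, SI ⊆ A → SO ⊆ B → Signals M SI SO →
    Signals Mf (SI.biUnion F) (SO.biUnion F)

end Systems

/-! ## Quantum networks -/

section Wiring

variable {Sys Box : Type} [Fintype Sys] [DecidableEq Box]

/-- The systems attached by `e` (the map `src` or `tgt` of a network) to the box `b`. -/
def portsAt (e : Sys → Option Box) (b : Box) : Finset Sys :=
  Finset.univ.filter fun s => e s = some b

end Wiring

/-- A finite, possibly cyclic, quantum network. Its systems are the in- and output systems of its
CP maps (boxes), an output and an input being identified when they are composed. So every
system is an output of at most one box (`src`) and an input of at most one box (`tgt`); it is a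
composition if it has both, and it is free otherwise. -/
structure Network where
  Sys : Type
  [fintypeSys : Fintype Sys]
  [decEqSys : DecidableEq Sys]
  Box : Type
  [fintypeBox : Fintype Box]
  [decEqBox : DecidableEq Box]
  dim : Sys → ℕ
  dim_pos : ∀ s, 0 < dim s
  src : Sys → Option Box
  tgt : Sys → Option Box
  attached : ∀ s, src s ≠ none ∨ tgt s ≠ none
  map : ∀ b : Box, SysMap dim (portsAt tgt b) (portsAt src b)
  cp : ∀ b, IsCP (map b)

attribute [instance] Network.fintypeSys Network.decEqSys Network.fintypeBox Network.decEqBox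

/-- A sub-network: a subset of the boxes and a subset of the compositions between these boxes. -/
structure SubNetwork (𝔑 : Network) where
  boxes : Finset 𝔑.Box
  comps : Finset 𝔑.Sys
  src_mem : ∀ s ∈ comps, ∃ b ∈ boxes, 𝔑.src s = some b
  tgt_mem : ∀ s ∈ comps, ∃ b ∈ boxes, 𝔑.tgt s = some b

namespace SubNetwork

variable {𝔑 : Network} (𝔰 : SubNetwork 𝔑)

/-- The free inputs: inputs of a box of the sub-network that are not composed in it. -/
def freeIn : Finset 𝔑.Sys :=
  Finset.univ.filter fun s => (∃ b ∈ 𝔰.boxes, 𝔑.tgt s = some b) ∧ s ∉ 𝔰.comps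

/-- The free outputs: outputs of a box of the sub-network that are not composed in it. -/
def freeOut : Finset 𝔑.Sys :=
  Finset.univ.filter fun s => (∃ b ∈ 𝔰.boxes, 𝔑.src s = some b) ∧ s ∉ 𝔰.comps

/-- The label that the inputs of the box `b` receive when the free inputs are labelled by `x` and
the composed systems by `w`. -/
def inLabel (x : Idx 𝔑.dim 𝔰.freeIn) (w : Idx 𝔑.dim 𝔰.comps) (b : 𝔑.Box) (hb : b ∈ 𝔰.boxes) :
    Idx 𝔑.dim (portsAt 𝔑.tgt b) :=
  fun s => if h : s.1 ∈ 𝔰.comps then w ⟨s.1, h⟩ else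
    x ⟨s.1, Finset.mem_filter.mpr
      ⟨Finset.mem_univ _, ⟨b, hb, (Finset.mem_filter.mp s.2).2⟩, h⟩⟩

/-- The label that the outputs of the box `b` receive when the free outputs are labelled by `y`
and the composed systems by `w`. -/
def outLabel (y : Idx 𝔑.dim 𝔰.freeOut) (w : Idx 𝔑.dim 𝔰.comps) (b : 𝔑.Box) (hb : b ∈ 𝔰.boxes) :
    Idx 𝔑.dim (portsAt 𝔑.src b) :=
  fun s => if h : s.1 ∈ 𝔰.comps then w ⟨s.1, h⟩ else
    y ⟨s.1, Finset.mem_filter.mpr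
      ⟨Finset.mem_univ _, ⟨b, hb, (Finset.mem_filter.mp s.2).2⟩, h⟩⟩

/-- The matrix element `⟨y| 𝒩 (|x⟩⟨x'|) |y'⟩` of the induced map `𝒩`. Loop composition of an output
with an input replaces a map `M` by `ρ ↦ ∑ i j, ⟨i| M (ρ ⊗ |i⟩⟨j|) |j⟩`; all compositions of the
sub-network are performed on the tensor product of its boxes, with `w` and `w'` collecting the
indices `i` and `j` of all of them. -/
def kernel (x x' : Idx 𝔑.dim 𝔰.freeIn) (y y' : Idx 𝔑.dim 𝔰.freeOut) : ℂ :=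
  ∑ w : Idx 𝔑.dim 𝔰.comps, ∑ w' : Idx 𝔑.dim 𝔰.comps, ∏ b : 𝔰.boxes,
    𝔑.map b.1
      (Matrix.single (𝔰.inLabel x w b.1 b.2) (𝔰.inLabel x' w' b.1 b.2) (1 : ℂ))
      (𝔰.outLabel y w b.1 b.2) (𝔰.outLabel y' w' b.1 b.2)

/-- The induced map of a sub-network, from its free inputs to its free outputs. -/
def induced : SysMap 𝔑.dim 𝔰.freeIn 𝔰.freeOut where
  toFun ρ := Matrix.of fun y y' => ∑ x, ∑ x', 𝔰.kernel x x' y y' * ρ x x'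
  map_add' ρ σ := by
    ext y y'
    simp [mul_add, Finset.sum_add_distrib]
  map_smul' c ρ := by
    ext y y'
    simp [Finset.mul_sum, mul_left_comm]

end SubNetwork

/-- The signalling structure of a network: `S₁` signals to `S₂` if it does so in the induced map
of some sub-network of which `S₁` are free inputs and `S₂` free outputs. -/
def Network.Sig (𝔑 : Network) (S₁ S₂ : Finset 𝔑.Sys) : Prop :=
  ∃ 𝔰 : SubNetwork 𝔑, Signals 𝔰.induced S₁ S₂

/-- The network `𝔑f` is a fine-graining of `𝔑` relative to `F`: distinct systems are sent to
disjoint sets of systems, and the induced map of every sub-network of `𝔑` has as a fine-graining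
the induced map of some sub-network of `𝔑f`. -/
def IsNetworkFineGraining (𝔑 𝔑f : Network) (F : 𝔑.Sys → Finset 𝔑f.Sys) : Prop :=
  (∀ s t, s ≠ t → Disjoint (F s) (F t)) ∧
  ∀ 𝔰 : SubNetwork 𝔑, ∃ 𝔰f : SubNetwork 𝔑f, IsFineGraining F 𝔰.induced 𝔰f.induced

/-! ## Compatibility and spacetime realisations -/

/-- Compatibility of the signalling structure of `𝔑` with the directed graph with edges `adj`,
under the assignment `E` of nodes to systems. A directed path has at least one edge. -/
def Compatible (𝔑 : Network) {V : Type*} (adj : V → V → Prop) (E : 𝔑.Sys → V) : Prop :=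
  ∀ S₁ S₂ : Finset 𝔑.Sys, Disjoint S₁ S₂ → 𝔑.Sig S₁ S₂ →
    ∃ s₁ ∈ S₁, ∃ s₂ ∈ S₂, Relation.TransGen adj (E s₁) (E s₂)

/-- A directed graph is acyclic if it has no directed cycle (a loop at a node being one). -/
def Acyclic {V : Type*} (adj : V → V → Prop) : Prop :=
  ∀ v, ¬ Relation.TransGen adj v v

/-- The region causal structure on a set of regions of the spacetime `T`: there is an edge from
`R₁` to `R₂` if some point of `R₁` strictly precedes some point of `R₂`. -/
def regionGraph {T : Type*} [PartialOrder T] (nodes : Set (Set T)) (R₁ R₂ : Set T) : Prop :=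
  R₁ ∈ nodes ∧ R₂ ∈ nodes ∧ ∃ p ∈ R₁, ∃ q ∈ R₂, p < q

/-- A spacetime realisation of the network `𝔑` in the spacetime `T`: an embedding of the systems
as regions, and a fine-graining of `𝔑` whose systems are embedded in the parts of partitions of
these regions, such that the region causal structure on the parts is acyclic. -/
structure SpacetimeRealisation (𝔑 : Network) (T : Type*) [PartialOrder T] where
  /-- the embedding -/
  emb : 𝔑.Sys → Set T
  /-- the fine-grained network -/
  fine : Network
  F : 𝔑.Sys → Finset fine.Sys
  isFineGraining : IsNetworkFineGraining 𝔑 fine F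
  /-- the embedding of the fine-grained systems -/
  fineEmb : fine.Sys → Set T
  /-- the region of a system is partitioned into the regions of its fine-grained systems -/
  cover : ∀ s, emb s = ⋃ t ∈ F s, fineEmb t
  disjoint : ∀ s, ∀ t ∈ F s, ∀ t' ∈ F s, t ≠ t' → Disjoint (fineEmb t) (fineEmb t')
  /-- every fine-grained system is embedded in one of the parts of these partitions -/
  is_part : ∀ t, ∃ s, ∃ t' ∈ F s, fineEmb t = fineEmb t'
  acyclic : Acyclic (regionGraph (Set.range fineEmb))

namespace SpacetimeRealisation

variable {𝔑 : Network} {T : Type*} [PartialOrder T] (R : SpacetimeRealisation 𝔑 T)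

/-- Relativistic causality: the signalling structure of the fine-grained network is compatible
with the fine-grained region causal structure. -/
def RelativisticCausality : Prop :=
  Compatible R.fine (regionGraph (Set.range R.fineEmb)) R.fineEmb

/-- The region causal structure on the image of the embedding is acyclic. -/
def AcyclicImage : Prop :=
  Acyclic (regionGraph (Set.range R.emb))

end SpacetimeRealisation

/-! ## ProcessMatrix matrices -/

/-- The Choi–Jamiołkowski matrix, on input times output, of a local map, in the convention
`[(id ⊗ M) (∑ |jj⟩⟨kk|)]ᵀ`. -/
def choi {m n : ℕ} (M : OpMap (Fin m) (Fin n)) : Matrix (Fin m × Fin n) (Fin m × Fin n) ℂ :=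
  (Matrix.of fun p q => M (Matrix.single p.1 q.1 (1 : ℂ)) p.2 q.2)ᵀ

/-- The basis of the tensor product of all in- and output systems of the parties. -/
abbrev LabIdx {N : ℕ} (dI dO : Fin N → ℕ) : Type := ∀ i, Fin (dI i) × Fin (dO i)

/-- The generalised Born rule `Tr ((⨂ i, M i) W)` for local maps `M i`. -/
def born {N : ℕ} {dI dO : Fin N → ℕ} (W : Matrix (LabIdx dI dO) (LabIdx dI dO) ℂ)
    (M : ∀ i, OpMap (Fin (dI i)) (Fin (dO i))) : ℂ :=
  ((Matrix.of fun p q : LabIdx dI dO => ∏ i, choi (M i) (p i) (q i)) * W).trace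

/-- An `N`-party process matrix: a positive operator on all in- and output systems of the parties
that gives total probability one for all local channels. -/
structure ProcessMatrix (N : ℕ) where
  dI : Fin N → ℕ
  dO : Fin N → ℕ
  dI_pos : ∀ i, 0 < dI i
  dO_pos : ∀ i, 0 < dO i
  W : Matrix (LabIdx dI dO) (LabIdx dI dO) ℂ
  posSemidef : W.PosSemidef
  normalised : ∀ M : ∀ i, OpMap (Fin (dI i)) (Fin (dO i)), (∀ i, IsCPTP (M i)) → born W M = 1

namespace ProcessMatrix

variable {N : ℕ} (P : ProcessMatrix N)

/-- A quantum instrument of party `i` for each setting in `A`, with outcomes in `X`. -/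
structure Instruments (i : Fin N) (A X : Type) [Fintype X] where
  op : A → X → OpMap (Fin (P.dI i)) (Fin (P.dO i))
  cp : ∀ a x, IsCP (op a x)
  tp : ∀ a, IsTP (∑ x, op a x)

/-- The probability that the parties in `K` obtain the outcomes `x`, given the settings `a` of
all parties: the sum of `P(x' | a)` over all `x'` that agree with `x` on `K`. -/
def marginal {A X : Fin N → Type} [∀ i, Fintype (X i)] [∀ i, DecidableEq (X i)]
    (J : ∀ i, P.Instruments i (A i) (X i)) (K : Finset (Fin N)) (x : ∀ i, X i) (a : ∀ i, A i) :
    ℂ :=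
  ∑ x' : ∀ i, X i, if ∀ i ∈ K, x' i = x i then born P.W fun i => (J i).op (a i) (x' i) else 0

/-- `P` is a fixed order process: for some strict partial order on the parties, whatever the local
instruments, the joint outcome distribution of every set `K` of parties depends only on the
settings of the parties in `K` and of those that precede a party in `K`. -/
def IsFixedOrder : Prop :=
  ∃ prec : Fin N → Fin N → Prop, (∀ i, ¬ prec i i) ∧ (∀ i j k, prec i j → prec j k → prec i k) ∧
    ∀ (A X : Fin N → Type) [∀ i, Fintype (X i)] [∀ i, DecidableEq (X i)]
      (J : ∀ i, P.Instruments i (A i) (X i)) (K : Finset (Fin N)) (a a' : ∀ i, A i),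
      (∀ j, (j ∈ K ∨ ∃ k ∈ K, prec j k) → a j = a' j) →
        ∀ x : ∀ i, X i, P.marginal J K x a = P.marginal J K x a'

end ProcessMatrix

/-! ## The process network -/

/-- The four kinds of systems of a local laboratory: the quantum systems received from and sent to
the environment, and the systems that carry the setting and the outcome. -/
inductive Port
  | inp | out | setting | outcome
  deriving DecidableEq

instance : Fintype Port where
  elems := {.inp, .out, .setting, .outcome}
  complete p := by cases p <;> decide

/-- Which box outputs a system of the process network; the box `none` is the environment, the box
`some i` is the laboratory of party `i`. -/
def procSrc {N : ℕ} (s : Fin N × Port) : Option (Option (Fin N)) :=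
  match s with
  | (_, .inp) => some none
  | (i, .out) => some (some i)
  | (_, .setting) => none
  | (i, .outcome) => some (some i)

/-- Which box a system of the process network is an input of. -/
def procTgt {N : ℕ} (s : Fin N × Port) : Option (Option (Fin N)) :=
  match s with
  | (i, .inp) => some (some i)
  | (_, .out) => some none
  | (i, .setting) => some (some i)
  | (_, .outcome) => none

/-- Dimensions of the systems of the process network. -/
def procDim {N : ℕ} (dI dO dS dX : Fin N → ℕ) (s : Fin N × Port) : ℕ :=
  match s with
  | (i, .inp) => dI i
  | (i, .out) => dO i
  | (i, .setting) => dS i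
  | (i, .outcome) => dX i

namespace ProcessMatrix

variable {N : ℕ} (P : ProcessMatrix N)

/-- Local laboratories for the parties of `P`: the operation of party `i` is a channel from
its input and a setting system to its output and an outcome system. (An instrument
`{M_{x|a}}` for each classical setting `a` is the case `ρ ⊗ |a⟩⟨a'| ↦ δ_{aa'} ∑ x, M_{x|a} ρ ⊗ |x⟩⟨x|`;
a plain channel is the case of one-dimensional setting and outcome.) -/
structure Labs where
  dS : Fin N → ℕ
  dX : Fin N → ℕ
  dS_pos : ∀ i, 0 < dS i
  dX_pos : ∀ i, 0 < dX i
  op : ∀ i, SysMap (procDim P.dI P.dO dS dX)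
    (portsAt procTgt (some i)) (portsAt procSrc (some i))
  cptp : ∀ i, IsCPTP (op i)

/-- In every laboratory whose input and output are both non-trivial, the available settings allow
the input to influence the output. -/
def Labs.Transmitting {P : ProcessMatrix N} (L : P.Labs) : Prop :=
  ∀ i, 1 < P.dI i → 1 < P.dO i → Signals (L.op i) {(i, Port.inp)} {(i, Port.out)}

/-- Combine labels of all the parties' input systems (outputs of the environment) and output systems
(inputs of the environment) into an index of `W`. -/
def pair (dS dX : Fin N → ℕ)
    (y : Idx (procDim P.dI P.dO dS dX) (portsAt procSrc none))
    (x : Idx (procDim P.dI P.dO dS dX) (portsAt procTgt none)) : LabIdx P.dI P.dO :=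
  fun i => (y ⟨(i, .inp), Finset.mem_filter.mpr ⟨Finset.mem_univ _, rfl⟩⟩,
    x ⟨(i, .out), Finset.mem_filter.mpr ⟨Finset.mem_univ _, rfl⟩⟩)

/-- The process map, from all parties' output systems to all parties' input systems, of which `W` is
the Choi matrix. -/
def map (dS dX : Fin N → ℕ) :
    SysMap (procDim P.dI P.dO dS dX) (portsAt procTgt none) (portsAt procSrc none) where
  toFun ρ := Matrix.of fun y y' =>
    ∑ x, ∑ x', P.W (P.pair dS dX y x) (P.pair dS dX y' x') * ρ x x'
  map_add' ρ σ := by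
    ext y y'
    simp [mul_add, Finset.sum_add_distrib]
  map_smul' c ρ := by
    ext y y'
    simp [Finset.mul_sum, mul_left_comm]

theorem map_cp (dS dX : Fin N → ℕ) : IsCP (P.map dS dX) := by
  intro n ρ hρ
  let D := procDim P.dI P.dO dS dX
  let X := Idx D (portsAt procTgt none)
  let Y := Idx D (portsAt procSrc none)
  let K : Matrix ((Y × X) × Fin n) ((Y × X) × Fin n) ℂ :=
    (P.W.submatrix (fun p : (Y × X) × Fin n => P.pair dS dX p.1.1 p.1.2)
        (fun p => P.pair dS dX p.1.1 p.1.2)) ⊙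
      (ρ.submatrix (fun p : (Y × X) × Fin n => (p.1.2, p.2)) (fun p => (p.1.2, p.2)))
  have hK : K.PosSemidef := (P.posSemidef.submatrix _).hadamard (hρ.submatrix _)
  let B : Matrix ((Y × X) × Fin n) (Y × Fin n) ℂ :=
    Matrix.of fun p q => if (p.1.1, p.2) = q then 1 else 0
  have h := hK.conjTranspose_mul_mul_same B
  convert h using 1
  ext ⟨y, a⟩ ⟨y', b⟩
  simp only [amplify, ProcessMatrix.map, Matrix.mul_apply, B, K, Fintype.sum_prod_type, Prod.ext_iff,
    ite_and, Matrix.of_apply, LinearMap.coe_mk, AddHom.coe_mk, Matrix.conjTranspose_apply,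
    Matrix.hadamard_apply, Matrix.submatrix_apply, mul_ite, mul_one, mul_zero,
    Finset.sum_ite_eq', Finset.mem_univ, if_true, Finset.sum_ite_irrel, Finset.sum_const_zero,
    apply_ite star, star_one, star_zero, ite_mul, one_mul, zero_mul]
  exact Finset.sum_comm

/-- The process network: the process map composed with the local operations through all in- and
output systems of the parties. -/
def network (L : P.Labs) : Network where
  Sys := Fin N × Port
  Box := Option (Fin N)
  dim := procDim P.dI P.dO L.dS L.dX
  dim_pos s := by
    rcases s with ⟨i, _ | _ | _ | _⟩
    exacts [P.dI_pos i, P.dO_pos i, L.dS_pos i, L.dX_pos i]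
  src := procSrc
  tgt := procTgt
  attached s := by
    rcases s with ⟨i, _ | _ | _ | _⟩ <;> simp [procSrc, procTgt]
  map b :=
    match b with
    | none => P.map L.dS L.dX
    | some i => L.op i
  cp b := by
    rcases b with _ | i
    exacts [P.map_cp L.dS L.dX, (L.cptp i).1]

end ProcessMatrix

end QST

end

/-! Assume relativistic causality and an acyclic coarse region graph; the claim is that `P` has a
fixed order. A fine-graining preserves signalling, so a coarse signalling relation between disjoint
sets yields a path between fine regions. Every fine region lies inside a coarse one, so the same
spacetime points give a path between coarse regions (`SpacetimeRealisation.exists_path`).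
Fine-graining therefore cannot remove a causal relation that signalling requires at the coarse
level.

Draw an edge from party `i` to party `j` if the output of `i` and the input of `j` are non-trivial
and a path of coarse regions leads from the former to the latter. Consecutive edges compose because
the laboratory between them has both systems non-trivial and so transmits; a cycle of parties would
likewise close up to a cycle of regions. Hence the transitive closure is a strict partial order.
Moreover the output of `j` can signal through `W` to a set of non-trivial inputs only if `j`
precedes one of their owners.

What remains concerns `W` alone (`isFixedOrder_of_signals`). In the marginal on `K`, every party
outside the causal past of `K` applies a channel. These channels are replaced, latest parties first,
by the channel that discards its input and prepares a fixed state. When the turn of `j` comes, its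
successors already discard their inputs, and its output does not signal to the other inputs, so only
the trace of its operation over its output matters; trace preservation fixes that
(`trace_tensor_mul_congr`). The marginal then no longer contains the settings of the replaced
parties. -/

namespace QST

/-! ### The trace-and-prepare channel -/

/-- Discard the input and prepare the basis state `o`. -/
noncomputable def tracePrepare {X Y : Type} [Fintype X] [DecidableEq Y] (o : Y) : OpMap X Y :=
  (LinearMap.toSpanSingleton ℂ _ (Matrix.single o o (1 : ℂ))) ∘ₗ Matrix.traceLinearMap X ℂ ℂ

theorem tracePrepare_apply {X Y : Type} [Fintype X] [DecidableEq Y] (o : Y)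
    (ρ : Matrix X X ℂ) : tracePrepare o ρ = ρ.trace • Matrix.single o o (1 : ℂ) := rfl

theorem isTP_tracePrepare {X Y : Type} [Fintype X] [Fintype Y] [DecidableEq Y] (o : Y) :
    IsTP (tracePrepare o : OpMap X Y) := by
  intro ρ
  simp [tracePrepare_apply]

theorem isCPTP_tracePrepare {X Y : Type} [Fintype X] [Fintype Y] [DecidableEq Y] (o : Y) :
    IsCPTP (tracePrepare o : OpMap X Y) := by
  refine ⟨fun n ρ hρ => ?_, isTP_tracePrepare o⟩
  have hs : (Matrix.single o o (1 : ℂ)).PosSemidef := by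
    rw [← Matrix.diagonal_single]
    refine Matrix.PosSemidef.diagonal fun i => ?_
    by_cases h : i = o
    · subst h; simp
    · simp [h]
  have hsum : (∑ x, ρ.submatrix (fun p : Y × Fin n => (x, p.2)) (fun p => (x, p.2))).PosSemidef :=
    Matrix.posSemidef_sum _ fun x _ => hρ.submatrix _
  have e : amplify (tracePrepare o) n ρ =
      (∑ x, ρ.submatrix (fun p : Y × Fin n => (x, p.2)) (fun p => (x, p.2))) ⊙
        (Matrix.single o o (1 : ℂ)).submatrix Prod.fst Prod.fst := by
    ext p q
    simp [amplify, tracePrepare_apply, Matrix.trace, Matrix.sum_apply]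
  rw [e]
  exact hsum.hadamard (hs.submatrix _)

/-! ### Non-signalling in matrix elements -/

section Systems

variable {Sys : Type} [DecidableEq Sys] {d : Sys → ℕ}

theorem override_eq_iff {S A : Finset Sys} (h : S ⊆ A) (u : Idx d S) (x x₀ : Idx d A) :
    x₀ = override u x ↔ u = restrict h x₀ ∧ ∀ s : A, s.1 ∉ S → x₀ s = x s := by
  constructor
  · rintro rfl
    refine ⟨?_, fun s hs => by simp [override, hs]⟩
    funext s
    simp [override, restrict]
  · rintro ⟨rfl, hx⟩
    funext s
    by_cases hs : s.1 ∈ S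
    · simp [override, restrict, hs]
    · simp [override, hs, hx s hs]

/-- The trace over `S` kills a matrix unit whose row and column differ on `S`; otherwise the
prepared state overwrites that part of both labels. -/
theorem localise_tracePrepare_single {S A : Finset Sys} (h : S ⊆ A) (o : Idx d S)
    (x₀ x₀' : Idx d A) :
    localise h (tracePrepare o) (Matrix.single x₀ x₀' (1 : ℂ)) =
      if restrict h x₀ = restrict h x₀' then
        Matrix.single (override o x₀) (override o x₀') (1 : ℂ) else 0 := by
  ext x x'
  have e : localise h (tracePrepare o) (Matrix.single x₀ x₀' (1 : ℂ)) x x' =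
      (∑ u, Matrix.single x₀ x₀' (1 : ℂ) (override u x) (override u x')) *
        Matrix.single o o (1 : ℂ) (restrict h x) (restrict h x') := rfl
  rw [e]
  -- Agreement off `S` is made opaque so that the simplifier treats it as an atom.
  obtain ⟨Q, hQ⟩ : ∃ Q : Idx d A → Idx d A → Prop, ∀ a b, Q a b ↔
      ∀ s : A, s.1 ∉ S → a s = b s := ⟨_, fun _ _ => Iff.rfl⟩
  have eq_override : ∀ (u : Idx d S) (y y₀ : Idx d A), y₀ = override u y ↔
      u = restrict h y₀ ∧ Q y₀ y := by
    intro u y y₀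
    rw [override_eq_iff h, hQ]
  have override_eq : ∀ y y₀ : Idx d A, override o y₀ = y ↔ o = restrict h y ∧ Q y₀ y := by
    intro y y₀
    rw [eq_comm, override_eq_iff h, hQ]
    exact and_congr_right fun _ => forall₂_congr fun _ _ => eq_comm
  have ite_zero_apply : ∀ (p : Prop) [Decidable p] (B : Matrix (Idx d A) (Idx d A) ℂ),
      (if p then B else 0) x x' = if p then B x x' else 0 := by
    intro p _ B; split_ifs <;> rfl
  rw [ite_zero_apply]
  classical
  simp only [Matrix.single_apply, eq_override, override_eq]
  by_cases hr : restrict h x₀ = restrict h x₀'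
  · rw [if_pos hr]
    simp only [← hr]
    by_cases h1 : Q x₀ x <;> by_cases h2 : Q x₀' x' <;> simp [h1, h2]
  · rw [if_neg hr]
    apply mul_eq_zero_of_left
    refine Finset.sum_eq_zero fun u _ => if_neg ?_
    rintro ⟨⟨rfl, _⟩, h2, _⟩
    exact hr h2

/-- Trace-and-prepare is one of the channels that non-signalling quantifies over; testing with it
alone, on matrix units, gives all that is used later. -/
theorem traceOut_eq_of_not_signals {A B SI SO : Finset Sys} {M : SysMap d A B}
    (h : ¬ Signals M SI SO) (hI : SI ⊆ A) (hO : SO ⊆ B) (o : Idx d SI) (x x' : Idx d A)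
    (y y' : Idx d SO) :
    ∑ z, M (Matrix.single x x' 1) (glue y z) (glue y' z) =
      if restrict hI x = restrict hI x' then
        ∑ z, M (Matrix.single (override o x) (override o x') 1) (glue y z) (glue y' z) else 0 := by
  have e : traceOut hO ∘ₗ M = traceOut hO ∘ₗ M ∘ₗ localise hI (tracePrepare o) := by
    by_contra hne
    exact h ⟨hI, hO, tracePrepare o, isCPTP_tracePrepare o, hne⟩
  have e' := congrFun (congrFun (LinearMap.congr_fun e (Matrix.single x x' 1)) y) y'
  simp only [LinearMap.comp_apply, localise_tracePrepare_single] at e'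
  refine Eq.trans e' ?_
  split_ifs
  · rfl
  · rw [map_zero, map_zero]
    rfl

/-- Labels of `B` are pairs of a label of a subset and a label of its complement. -/
def glueEquiv {S B : Finset Sys} (h : S ⊆ B) : Idx d S × Idx d (B \ S) ≃ Idx d B where
  toFun p := glue p.1 p.2
  invFun y := (restrict h y, restrict Finset.sdiff_subset y)
  left_inv p := by
    refine Prod.ext (funext fun s => ?_) (funext fun s => ?_)
    · simp [restrict, glue]
    · simp [restrict, glue, (Finset.mem_sdiff.mp s.2).2]
  right_inv y := by
    funext s
    by_cases hs : s.1 ∈ S <;> simp [restrict, glue, hs]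

theorem sum_glue {S B : Finset Sys} (h : S ⊆ B) (f : Idx d B → ℂ) :
    ∑ y, f y = ∑ u : Idx d S, ∑ z : Idx d (B \ S), f (glue u z) := by
  rw [← (glueEquiv h).sum_comp, Fintype.sum_prod_type]
  rfl

theorem restrict_glue {S B : Finset Sys} (h : S ⊆ B) (u : Idx d S) (z : Idx d (B \ S)) :
    restrict h (glue u z) = u := by
  funext s
  simp [restrict, glue]

theorem override_glue {S B : Finset Sys} (o u : Idx d S) (z : Idx d (B \ S)) :
    override o (glue u z) = (glue o z : Idx d B) := by
  funext s
  by_cases hs : s.1 ∈ S <;> simp [override, glue, hs]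

/-- Transports signalling between maps whose sets of systems are equal only propositionally, as for
a box and its one-box sub-network. -/
theorem signals_of_single_eq {A A' B B' : Finset Sys} (hA : A' = A) (hB : B' = B)
    {M : SysMap d A B} {M' : SysMap d A' B'}
    (h : ∀ x x' y y', M' (Matrix.single x x' 1) y y' =
      M (Matrix.single (restrict hA.ge x) (restrict hA.ge x') 1) (restrict hB.ge y)
        (restrict hB.ge y'))
    {S₁ S₂ : Finset Sys} (hM : Signals M S₁ S₂) : Signals M' S₁ S₂ := by
  subst hA hB
  have e : M' = M := by
    refine Matrix.ext_linearMap _ fun x x' => LinearMap.ext_ring ?_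
    ext y y'
    exact h x x' y y'
  rwa [e]

end Systems

/-! ### From signalling to paths of regions -/

/-- The sub-network that consists of a single box. -/
def Network.singleBox (𝔑 : Network) (b : 𝔑.Box) : SubNetwork 𝔑 where
  boxes := {b}
  comps := ∅
  src_mem := by simp
  tgt_mem := by simp

theorem Network.sig_of_signals_map (𝔑 : Network) (b : 𝔑.Box) {S₁ S₂ : Finset 𝔑.Sys}
    (h : Signals (𝔑.map b) S₁ S₂) : 𝔑.Sig S₁ S₂ := by
  have hA : (𝔑.singleBox b).freeIn = portsAt 𝔑.tgt b := by
    ext s; simp [SubNetwork.freeIn, portsAt, Network.singleBox]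
  have hB : (𝔑.singleBox b).freeOut = portsAt 𝔑.src b := by
    ext s; simp [SubNetwork.freeOut, portsAt, Network.singleBox]
  refine ⟨𝔑.singleBox b, signals_of_single_eq hA hB (fun x x' y y' => ?_) h⟩
  have e : (𝔑.singleBox b).induced (Matrix.single x x' 1) y y' =
      (𝔑.singleBox b).kernel x x' y y' := by
    change ∑ u, ∑ u', (𝔑.singleBox b).kernel u u' y y' * Matrix.single x x' (1 : ℂ) u u' = _
    simp [Matrix.single_apply, ite_and]
  rw [e]
  -- With no compositions and one box, the loop sums and the product each have a single term.
  let _ : Unique (Idx 𝔑.dim (𝔑.singleBox b).comps) :=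
    ⟨⟨fun s => absurd s.2 (Finset.notMem_empty _)⟩,
      fun _ => funext fun s => absurd s.2 (Finset.notMem_empty _)⟩
  let _ : Unique (𝔑.singleBox b).boxes :=
    ⟨⟨⟨b, Finset.mem_singleton_self b⟩⟩, fun c => Subtype.ext (Finset.mem_singleton.mp c.2)⟩
  rw [SubNetwork.kernel, Fintype.sum_unique, Fintype.sum_unique, Fintype.prod_unique]
  rfl

theorem SpacetimeRealisation.exists_path {𝔑 : Network} {T : Type*} [PartialOrder T]
    (R : SpacetimeRealisation 𝔑 T) (hR : R.RelativisticCausality) {S₁ S₂ : Finset 𝔑.Sys}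
    (hd : Disjoint S₁ S₂) (h : 𝔑.Sig S₁ S₂) :
    ∃ s₁ ∈ S₁, ∃ s₂ ∈ S₂,
      Relation.TransGen (regionGraph (Set.range R.emb)) (R.emb s₁) (R.emb s₂) := by
  obtain ⟨𝔰, hs⟩ := h
  obtain ⟨𝔰f, -, -, -, hf⟩ := R.isFineGraining.2 𝔰
  have hfs := hf S₁ S₂ hs.1 hs.2.1 hs
  have hdf : Disjoint (S₁.biUnion R.F) (S₂.biUnion R.F) := by
    rw [Finset.disjoint_biUnion_left]
    intro s hs
    rw [Finset.disjoint_biUnion_right]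
    intro t ht
    exact R.isFineGraining.1 s t fun e => Finset.disjoint_left.mp hd hs (e ▸ ht)
  obtain ⟨t₁, ht₁, t₂, ht₂, hp⟩ := hR _ _ hdf ⟨𝔰f, hfs⟩
  obtain ⟨s₁, hs₁, ht₁⟩ := Finset.mem_biUnion.mp ht₁
  obtain ⟨s₂, hs₂, ht₂⟩ := Finset.mem_biUnion.mp ht₂
  have hsub : ∀ s, ∀ t ∈ R.F s, R.fineEmb t ⊆ R.emb s := fun s t ht => by
    rw [R.cover s]
    exact Set.subset_biUnion_of_mem (u := fun t => R.fineEmb t) ht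
  refine ⟨s₁, hs₁, s₂, hs₂, ?_⟩
  -- The coarse region at the end stays arbitrary during the induction: each intermediate fine
  -- region is placed in some coarse region by `is_part`, and the edges on both sides must use that
  -- same choice.
  have lift : ∀ V, Relation.TransGen (regionGraph (Set.range R.fineEmb)) (R.fineEmb t₁) V →
      ∀ s, V ⊆ R.emb s →
        Relation.TransGen (regionGraph (Set.range R.emb)) (R.emb s₁) (R.emb s) := by
    intro V hV
    induction hV with
    | single e =>
      intro s hs
      obtain ⟨-, -, p, hp, q, hq, hpq⟩ := e
      exact .single ⟨⟨s₁, rfl⟩, ⟨s, rfl⟩, p, hsub s₁ t₁ ht₁ hp, q, hs hq, hpq⟩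
    | tail _ e ih =>
      intro s hs
      obtain ⟨⟨t, rfl⟩, -, p, hp, q, hq, hpq⟩ := e
      obtain ⟨s', t', ht', e'⟩ := R.is_part t
      have hs' : R.fineEmb t ⊆ R.emb s' := e' ▸ hsub s' t' ht'
      exact (ih s' hs').tail ⟨⟨s', rfl⟩, ⟨s, rfl⟩, p, hs' hp, q, hs hq, hpq⟩
  exact lift _ hp s₂ (hsub s₂ t₂ ht₂)

/-! ### Contracting the process matrix with local operators -/

theorem mem_portsAt {Sys Box : Type} [Fintype Sys] [DecidableEq Box] {e : Sys → Option Box}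
    {b : Box} {s : Sys} : s ∈ portsAt e b ↔ e s = some b := by
  simp [portsAt]

theorem mem_portsAt_procSrc_none {N : ℕ} {s : Fin N × Port} :
    s ∈ portsAt procSrc none ↔ s.2 = Port.inp := by
  rw [mem_portsAt]
  rcases s with ⟨i, _ | _ | _ | _⟩ <;> simp [procSrc]

theorem mem_portsAt_procTgt_none {N : ℕ} {s : Fin N × Port} :
    s ∈ portsAt procTgt none ↔ s.2 = Port.out := by
  rw [mem_portsAt]
  rcases s with ⟨i, _ | _ | _ | _⟩ <;> simp [procTgt]

theorem procDim_of_inp {N : ℕ} {dI dO dS dX : Fin N → ℕ} {s : Fin N × Port}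
    (h : s.2 = Port.inp) : procDim dI dO dS dX s = dI s.1 := by
  rcases s with ⟨i, p⟩
  cases h
  rfl

theorem procDim_of_out {N : ℕ} {dI dO dS dX : Fin N → ℕ} {s : Fin N × Port}
    (h : s.2 = Port.out) : procDim dI dO dS dX s = dO s.1 := by
  rcases s with ⟨i, p⟩
  cases h
  rfl

theorem sum_sum_glue {Sys : Type} [DecidableEq Sys] {d : Sys → ℕ} {S B : Finset Sys} (h : S ⊆ B)
    (f : Idx d B → Idx d B → ℂ) :
    ∑ y, ∑ y', f y y' = ∑ u : Idx d S, ∑ u' : Idx d S, ∑ z : Idx d (B \ S),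
      ∑ z' : Idx d (B \ S), f (glue u z) (glue u' z') := by
  rw [sum_glue h]
  refine Finset.sum_congr rfl fun u _ => ?_
  refine (Finset.sum_congr rfl fun z _ => sum_glue h _).trans ?_
  rw [Finset.sum_comm]

namespace ProcessMatrix

variable {N : ℕ} (P : ProcessMatrix N) (dS dX : Fin N → ℕ)

theorem pair_bijective : Function.Bijective
    fun p : Idx (procDim P.dI P.dO dS dX) (portsAt procSrc none) ×
      Idx (procDim P.dI P.dO dS dX) (portsAt procTgt none) => P.pair dS dX p.1 p.2 := by
  constructor
  · rintro ⟨y, x⟩ ⟨y', x'⟩ h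
    refine Prod.ext (funext ?_) (funext ?_)
    · rintro ⟨⟨i, _ | _ | _ | _⟩, hs⟩
      · exact congrArg Prod.fst (congrFun h i)
      all_goals cases mem_portsAt_procSrc_none.mp hs
    · rintro ⟨⟨i, _ | _ | _ | _⟩, hs⟩
      · cases mem_portsAt_procTgt_none.mp hs
      · exact congrArg Prod.snd (congrFun h i)
      all_goals cases mem_portsAt_procTgt_none.mp hs
  · intro p
    exact ⟨(fun s => Fin.cast (procDim_of_inp (mem_portsAt_procSrc_none.mp s.2)).symm (p s.1.1).1,
      fun s => Fin.cast (procDim_of_out (mem_portsAt_procTgt_none.mp s.2)).symm (p s.1.1).2), rfl⟩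

/-- The operator `⨂ i, C i`. -/
def tensor {N : ℕ} {dI dO : Fin N → ℕ}
    (C : ∀ i, Matrix (Fin (dI i) × Fin (dO i)) (Fin (dI i) × Fin (dO i)) ℂ) :
    Matrix (LabIdx dI dO) (LabIdx dI dO) ℂ :=
  Matrix.of fun p q => ∏ i, C i (p i) (q i)

theorem sum_labIdx (f : LabIdx P.dI P.dO → ℂ) :
    ∑ p, f p = ∑ x, ∑ y, f (P.pair dS dX y x) := by
  rw [← (Equiv.ofBijective _ (P.pair_bijective dS dX)).sum_comp, Fintype.sum_prod_type_right]
  rfl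

theorem sum_sum_labIdx (f : LabIdx P.dI P.dO → LabIdx P.dI P.dO → ℂ) :
    ∑ p, ∑ q, f p q = ∑ x, ∑ x', ∑ y, ∑ y', f (P.pair dS dX y x) (P.pair dS dX y' x') := by
  rw [P.sum_labIdx dS dX]
  refine Finset.sum_congr rfl fun x _ => ?_
  refine (Finset.sum_congr rfl fun y _ => P.sum_labIdx dS dX _).trans ?_
  rw [Finset.sum_comm]

theorem trace_tensor_mul
    (C : ∀ i, Matrix (Fin (P.dI i) × Fin (P.dO i)) (Fin (P.dI i) × Fin (P.dO i)) ℂ) :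
    (tensor C * P.W).trace = ∑ x, ∑ x', ∑ y, ∑ y',
      tensor C (P.pair dS dX y x) (P.pair dS dX y' x') *
        P.W (P.pair dS dX y' x') (P.pair dS dX y x) :=
  P.sum_sum_labIdx dS dX fun p q => tensor C p q * P.W q p

theorem map_single (x x' : Idx (procDim P.dI P.dO dS dX) (portsAt procTgt none))
    (y y' : Idx (procDim P.dI P.dO dS dX) (portsAt procSrc none)) :
    P.map dS dX (Matrix.single x x' 1) y y' =
      P.W (P.pair dS dX y x) (P.pair dS dX y' x') := by
  change ∑ u, ∑ u', P.W (P.pair dS dX y u) (P.pair dS dX y' u') *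
    Matrix.single x x' (1 : ℂ) u u' = _
  simp [Matrix.single_apply, ite_and]

/-- A Choi operator of a map that discards its input and prepares an operator. -/
def Discards {m n : ℕ} (C : Matrix (Fin m × Fin n) (Fin m × Fin n) ℂ) : Prop :=
  ∃ τ : Matrix (Fin n) (Fin n) ℂ, ∀ p q, C p q = if p.1 = q.1 then τ p.2 q.2 else 0

/-- A discarding factor is a delta on its input label, so contraction with it is a partial trace
over the inputs outside `S`. The weight `G` does not depend on `V`, so it serves `W` both before and
after an output label is overwritten. -/
theorem exists_sum_eq_of_discards
    {C : ∀ i, Matrix (Fin (P.dI i) × Fin (P.dO i)) (Fin (P.dI i) × Fin (P.dO i)) ℂ}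
    {S : Finset (Fin N × Port)} (hS : S ⊆ portsAt procSrc none)
    (hC : ∀ i, (i, Port.inp) ∉ S → Discards (C i))
    (x x' : Idx (procDim P.dI P.dO dS dX) (portsAt procTgt none)) :
    ∃ G : Idx (procDim P.dI P.dO dS dX) S → Idx (procDim P.dI P.dO dS dX) S → ℂ,
      ∀ V : Idx (procDim P.dI P.dO dS dX) (portsAt procSrc none) →
        Idx (procDim P.dI P.dO dS dX) (portsAt procSrc none) → ℂ,
      ∑ y, ∑ y', tensor C (P.pair dS dX y x) (P.pair dS dX y' x') * V y' y =
        ∑ s, ∑ s', G s s' * ∑ z, V (glue s' z) (glue s z) := by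
  choose τ hτ using hC
  let G : Idx (procDim P.dI P.dO dS dX) S → Idx (procDim P.dI P.dO dS dX) S → ℂ :=
    fun s s' => ∏ i, if h : (i, Port.inp) ∈ S then
      C i (s ⟨(i, .inp), h⟩, x ⟨(i, .out), mem_portsAt_procTgt_none.mpr rfl⟩)
        (s' ⟨(i, .inp), h⟩, x' ⟨(i, .out), mem_portsAt_procTgt_none.mpr rfl⟩)
      else τ i h (x ⟨(i, .out), mem_portsAt_procTgt_none.mpr rfl⟩)
        (x' ⟨(i, .out), mem_portsAt_procTgt_none.mpr rfl⟩)
  have hG : ∀ s s' z z', tensor C (P.pair dS dX (glue s z) x) (P.pair dS dX (glue s' z') x') =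
      if z = z' then G s s' else 0 := by
    intro s s' z z'
    split_ifs with hz
    · subst hz
      rw [tensor, Matrix.of_apply]
      refine Finset.prod_congr rfl fun i _ => ?_
      by_cases h : (i, Port.inp) ∈ S
      · simp [h, pair, glue]
      · rw [hτ i h, if_pos (by simp [pair, glue, h]; rfl), dif_neg h]
        rfl
    · obtain ⟨⟨⟨i, p⟩, hk⟩, hne⟩ := Function.ne_iff.mp hz
      obtain ⟨hk1, hk2⟩ := Finset.mem_sdiff.mp hk
      obtain rfl : p = .inp := mem_portsAt_procSrc_none.mp hk1
      refine Finset.prod_eq_zero (Finset.mem_univ i) ?_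
      rw [hτ i hk2]
      refine if_neg ?_
      simp only [pair, glue, hk2, dite_false]
      exact hne
  refine ⟨G, fun V => ?_⟩
  rw [sum_sum_glue hS]
  refine Finset.sum_congr rfl fun s _ => Finset.sum_congr rfl fun s' _ => ?_
  simp [hG, Finset.mul_sum]

/-- Since all inputs outside `S` are traced out, non-signalling lets the labels on `U` in `W` be set
to `o` and forces them to be diagonal. The local operators then enter only through their partial
trace over `U`. -/
theorem trace_tensor_mul_eq_of_not_signals
    {C : ∀ i, Matrix (Fin (P.dI i) × Fin (P.dO i)) (Fin (P.dI i) × Fin (P.dO i)) ℂ}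
    {S U : Finset (Fin N × Port)} (hS : S ⊆ portsAt procSrc none) (hU : U ⊆ portsAt procTgt none)
    (h : ¬ Signals (P.map dS dX) U S)
    (hC : ∀ i, (i, Port.inp) ∉ S → Discards (C i)) (o : Idx (procDim P.dI P.dO dS dX) U) :
    (tensor C * P.W).trace = ∑ w, ∑ w', ∑ y, ∑ y',
      (∑ u : Idx (procDim P.dI P.dO dS dX) U,
        tensor C (P.pair dS dX y (glue u w)) (P.pair dS dX y' (glue u w'))) *
          P.W (P.pair dS dX y' (glue o w')) (P.pair dS dX y (glue o w)) := by
  have step : ∀ x x', ∑ y, ∑ y', tensor C (P.pair dS dX y x) (P.pair dS dX y' x') *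
        P.W (P.pair dS dX y' x') (P.pair dS dX y x) =
      if restrict hU x = restrict hU x' then
        ∑ y, ∑ y', tensor C (P.pair dS dX y x) (P.pair dS dX y' x') *
          P.W (P.pair dS dX y' (override o x')) (P.pair dS dX y (override o x)) else 0 := by
    intro x x'
    obtain ⟨G, hG⟩ := P.exists_sum_eq_of_discards dS dX hS hC x x'
    rw [hG fun y' y => P.W (P.pair dS dX y' x') (P.pair dS dX y x),
      hG fun y' y => P.W (P.pair dS dX y' (override o x')) (P.pair dS dX y (override o x))]
    have key := fun s s' => traceOut_eq_of_not_signals h hU hS o x' x s' s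
    simp only [map_single] at key
    simp only [key, eq_comm (a := restrict hU x')]
    split_ifs <;> simp
  rw [P.trace_tensor_mul dS dX]
  simp only [step]
  rw [sum_sum_glue hU]
  simp only [restrict_glue, override_glue]
  have collapse : ∀ u : Idx (procDim P.dI P.dO dS dX) U,
      ∀ H : Idx (procDim P.dI P.dO dS dX) U →
        Idx (procDim P.dI P.dO dS dX) (portsAt procTgt none \ U) →
        Idx (procDim P.dI P.dO dS dX) (portsAt procTgt none \ U) → ℂ,
      (∑ u', ∑ w, ∑ w', if u = u' then H u' w w' else 0) = ∑ w, ∑ w', H u w w' := by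
    intro u H
    rw [Finset.sum_eq_single u (fun u' _ hu => by simp [hu.symm]) (by simp)]
    simp
  refine (Finset.sum_congr rfl fun u _ => collapse u fun u' w w' => ∑ y, ∑ y',
    tensor C (P.pair dS dX y (glue u w)) (P.pair dS dX y' (glue u' w')) *
      P.W (P.pair dS dX y' (glue o w')) (P.pair dS dX y (glue o w))).trans ?_
  rw [Finset.sum_comm]
  refine Finset.sum_congr rfl fun w _ => ?_
  rw [Finset.sum_comm]
  refine Finset.sum_congr rfl fun w' _ => ?_
  rw [Finset.sum_comm]
  refine Finset.sum_congr rfl fun y _ => ?_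
  rw [Finset.sum_comm]
  exact Finset.sum_congr rfl fun y' _ => (Finset.sum_mul _ _ _).symm

theorem trace_tensor_mul_congr
    {C C' : ∀ i, Matrix (Fin (P.dI i) × Fin (P.dO i)) (Fin (P.dI i) × Fin (P.dO i)) ℂ}
    {S : Finset (Fin N × Port)} (hS : S ⊆ portsAt procSrc none) (j : Fin N)
    (h : ¬ Signals (P.map dS dX) {(j, Port.out)} S)
    (hC : ∀ i, (i, Port.inp) ∉ S → Discards (C i))
    (hC' : ∀ i, (i, Port.inp) ∉ S → Discards (C' i)) (hne : ∀ i, i ≠ j → C i = C' i)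
    (hj : ∀ a a', ∑ b, C j (a, b) (a', b) = ∑ b, C' j (a, b) (a', b)) :
    (tensor C * P.W).trace = (tensor C' * P.W).trace := by
  have hU : {(j, Port.out)} ⊆ portsAt (procTgt (N := N)) none := by
    simp [mem_portsAt_procTgt_none]
  -- Setting and outcome dimensions may vanish here; positivity is needed only at the output of `j`.
  have hd : ∀ s, 0 < procDim P.dI P.dO dS dX s ∨ s ≠ (j, Port.out) := by
    intro s
    by_cases hs : s = (j, Port.out)
    · subst hs; exact .inl (P.dO_pos j)
    · exact .inr hs
  let o : Idx (procDim P.dI P.dO dS dX) {(j, Port.out)} := fun s =>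
    ⟨0, (hd s).resolve_right fun hn => hn (Finset.mem_singleton.mp s.2)⟩
  rw [P.trace_tensor_mul_eq_of_not_signals dS dX hS hU h hC o,
    P.trace_tensor_mul_eq_of_not_signals dS dX hS hU h hC' o]
  refine Finset.sum_congr rfl fun w _ => Finset.sum_congr rfl fun w' _ =>
    Finset.sum_congr rfl fun y _ => Finset.sum_congr rfl fun y' _ => ?_
  congr 1
  let a : Fin (P.dI j) := (P.pair dS dX y (glue o w) j).1
  let a' : Fin (P.dI j) := (P.pair dS dX y' (glue o w') j).1
  let e : Idx (procDim P.dI P.dO dS dX) {(j, Port.out)} ≃ Fin (P.dO j) :=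
    { toFun := fun u => u ⟨(j, .out), Finset.mem_singleton_self _⟩
      invFun := fun b s => Fin.cast (by rw [Finset.mem_singleton.mp s.2]; rfl) b
      left_inv := by
        intro u
        funext ⟨s, hs⟩
        obtain rfl := Finset.mem_singleton.mp hs
        rfl
      right_inv := fun b => rfl }
  -- Only the factor of party `j` sees the label `u`, so the sum over it is the trace of that factor
  -- over its output.
  have expand : ∀ D : ∀ i, Matrix (Fin (P.dI i) × Fin (P.dO i)) (Fin (P.dI i) × Fin (P.dO i)) ℂ,
      ∑ u, tensor D (P.pair dS dX y (glue u w)) (P.pair dS dX y' (glue u w')) =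
        (∑ b, D j (a, b) (a', b)) * ∏ i ∈ Finset.univ.erase j,
          D i (P.pair dS dX y (glue o w) i) (P.pair dS dX y' (glue o w') i) := by
    intro D
    rw [← e.sum_comp, Finset.sum_mul]
    refine Finset.sum_congr rfl fun u _ => ?_
    rw [tensor, Matrix.of_apply, ← Finset.mul_prod_erase _ _ (Finset.mem_univ j)]
    congr 1
    · simp [pair, glue, a, a']
      rfl
    · refine Finset.prod_congr rfl fun i hi => ?_
      have hij := (Finset.mem_erase.mp hi).1
      simp [pair, glue, hij]
  rw [expand, expand, hj]
  congr 1
  exact Finset.prod_congr rfl fun i hi => by rw [hne i (Finset.mem_erase.mp hi).1]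

end ProcessMatrix

/-! ### Fixed order from non-signalling -/

namespace ProcessMatrix

variable {N : ℕ} (P : ProcessMatrix N)

theorem choi_apply {m n : ℕ} (M : OpMap (Fin m) (Fin n)) (p q : Fin m × Fin n) :
    choi M p q = M (Matrix.single q.1 p.1 1) q.2 p.2 := rfl

theorem choi_sum {m n : ℕ} {X : Type} [Fintype X] (M : X → OpMap (Fin m) (Fin n)) :
    choi (∑ x, M x) = ∑ x, choi (M x) := by
  ext p q
  simp [choi_apply, Matrix.sum_apply]

theorem sum_choi_of_isTP {m n : ℕ} {M : OpMap (Fin m) (Fin n)} (h : IsTP M) (a a' : Fin m) :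
    ∑ b, choi M (a, b) (a', b) = if a = a' then 1 else 0 := by
  have := h (Matrix.single a' a 1)
  simp only [Matrix.trace, Matrix.diag_apply] at this
  simp only [choi_apply, this]
  by_cases haa : a = a' <;> simp [Matrix.single_apply, haa, ite_and]

/-- The delta on the input label is vacuous here. Thus trivial inputs can be left out of the set
that must not be signalled to, whatever their party does. -/
theorem discards_of_le_one {m n : ℕ} (hm : m ≤ 1)
    (C : Matrix (Fin m × Fin n) (Fin m × Fin n) ℂ) : Discards C := by
  have : Subsingleton (Fin m) := Fin.subsingleton_iff_le_one.mpr hm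
  by_cases h : Nonempty (Fin m)
  · obtain ⟨a⟩ := h
    refine ⟨Matrix.of fun b b' => C (a, b) (a, b'), fun p q => ?_⟩
    rw [if_pos (Subsingleton.elim _ _)]
    exact congrArg₂ C (Prod.ext (Subsingleton.elim _ _) rfl) (Prod.ext (Subsingleton.elim _ _) rfl)
  · exact ⟨0, fun p => absurd ⟨p.1⟩ h⟩

theorem discards_choi_tracePrepare {m n : ℕ} (o : Fin n) :
    Discards (choi (tracePrepare o : OpMap (Fin m) (Fin n))) := by
  refine ⟨Matrix.single o o 1, fun p q => ?_⟩
  rw [choi_apply, tracePrepare_apply]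
  by_cases h : p.1 = q.1
  · simp [h, Matrix.single_apply, and_comm]
  · simp [h, Matrix.trace_single_eq_of_ne _ _ _ (Ne.symm h)]

theorem born_eq {dI dO : Fin N → ℕ} (W : Matrix (LabIdx dI dO) (LabIdx dI dO) ℂ)
    (M : ∀ i, OpMap (Fin (dI i)) (Fin (dO i))) :
    born W M = (tensor (fun i => choi (M i)) * W).trace := rfl

theorem sum_tensor {dI dO : Fin N → ℕ} {X : Fin N → Type} [∀ i, Fintype (X i)]
    (C : ∀ i, X i → Matrix (Fin (dI i) × Fin (dO i)) (Fin (dI i) × Fin (dO i)) ℂ) :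
    ∑ x : ∀ i, X i, tensor (fun i => C i (x i)) = tensor fun i => ∑ x, C i x := by
  ext p q
  simp only [tensor, Matrix.sum_apply, Matrix.of_apply]
  rw [Finset.prod_univ_sum, Fintype.piFinset_univ]

/-- Summing over outcomes distributes over the tensor product: a party outside `K` contributes its
total channel. -/
theorem marginal_eq {A X : Fin N → Type} [∀ i, Fintype (X i)] [∀ i, DecidableEq (X i)]
    (J : ∀ i, P.Instruments i (A i) (X i)) (K : Finset (Fin N)) (x : ∀ i, X i) (a : ∀ i, A i) :
    P.marginal J K x a = (tensor (fun i => choi (if i ∈ K then (J i).op (a i) (x i)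
      else ∑ x', (J i).op (a i) x')) * P.W).trace := by
  -- Building the constraint on `K` into the factors makes the restricted sum a full product sum.
  let C : ∀ i, X i → Matrix (Fin (P.dI i) × Fin (P.dO i)) (Fin (P.dI i) × Fin (P.dO i)) ℂ :=
    fun i x' => if i ∈ K → x' = x i then choi ((J i).op (a i) x') else 0
  have hC : ∀ i, ∑ x', C i x' = choi (if i ∈ K then (J i).op (a i) (x i)
      else ∑ x', (J i).op (a i) x') := by
    intro i
    by_cases hi : i ∈ K
    · simp [C, hi]
    · simp [C, hi, choi_sum]
  simp only [← hC]
  rw [← sum_tensor, Finset.sum_mul, Matrix.trace_sum, marginal]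
  refine Finset.sum_congr rfl fun x' _ => ?_
  split_ifs with h
  · rw [born_eq]
    congr 3
    funext i
    exact (if_pos (h i)).symm
  · push Not at h
    obtain ⟨i, hi, hne⟩ := h
    have : tensor (fun i => C i (x' i)) = 0 := by
      ext p q
      refine Finset.prod_eq_zero (Finset.mem_univ i) ?_
      simp [C, hi, hne]
    rw [this, Matrix.zero_mul, Matrix.trace_zero]

/-- Induction over the up-closed set `U`, peeling off a minimal party so that all its successors
have been replaced before it. -/
theorem trace_tensor_mul_replace (dS dX : Fin N → ℕ) {prec : Fin N → Fin N → Prop}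
    (irrefl : ∀ i, ¬ prec i i) (trans : ∀ i j k, prec i j → prec j k → prec i k)
    (hns : ∀ j, 1 < P.dO j → ∀ S : Finset (Fin N × Port), (∀ s ∈ S, s.2 = Port.inp) →
      (∀ s ∈ S, 1 < P.dI s.1) → Signals (P.map dS dX) {(j, Port.out)} S → ∃ s ∈ S, prec j s.1)
    {D : ∀ i, Matrix (Fin (P.dI i) × Fin (P.dO i)) (Fin (P.dI i) × Fin (P.dO i)) ℂ}
    (hD : ∀ i, Discards (D i))
    (hD' : ∀ i a a', ∑ b, D i (a, b) (a', b) = if a = a' then 1 else 0)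
    (C : ∀ i, Matrix (Fin (P.dI i) × Fin (P.dO i)) (Fin (P.dI i) × Fin (P.dO i)) ℂ)
    (U : Finset (Fin N)) (hU : ∀ i ∈ U, ∀ j, prec i j → j ∈ U)
    (hC : ∀ i ∈ U, ∀ a a', ∑ b, C i (a, b) (a', b) = if a = a' then 1 else 0) :
    (tensor C * P.W).trace = (tensor (fun i => if i ∈ U then D i else C i) * P.W).trace := by
  induction U using Finset.strongInduction with
  | H U ih =>
    rcases U.eq_empty_or_nonempty with rfl | hne
    · simp
    have : IsTrans (Fin N) prec := ⟨trans⟩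
    have : Std.Irrefl prec := ⟨irrefl⟩
    -- Minimality of `j` is what keeps `U.erase j` up-closed.
    obtain ⟨j, hjU, hj⟩ := (Finite.wellFounded_of_trans_of_irrefl prec).has_min (U : Set (Fin N))
      hne
    rw [Finset.mem_coe] at hjU
    rw [ih (U.erase j) (Finset.erase_ssubset hjU)
      (fun i hi k hik => Finset.mem_erase.mpr ⟨fun e => hj i (Finset.mem_of_mem_erase hi) (e ▸ hik),
        hU i (Finset.mem_of_mem_erase hi) k hik⟩)
      (fun i hi => hC i (Finset.mem_of_mem_erase hi))]
    rcases Nat.lt_or_ge 1 (P.dO j) with hdj | hdj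
    · let S : Finset (Fin N × Port) :=
        Finset.univ.filter fun s => s.2 = Port.inp ∧ s.1 ∉ U.erase j ∧ 1 < P.dI s.1
      have hS : ∀ s, s ∈ S ↔ s.2 = Port.inp ∧ s.1 ∉ U.erase j ∧ 1 < P.dI s.1 := by
        simp [S]
      have hdis : ∀ V : Finset (Fin N), U.erase j ⊆ V → ∀ i, (i, Port.inp) ∉ S →
          Discards (if i ∈ V then D i else C i) := by
        intro V hV i hi
        by_cases hiU : i ∈ U.erase j
        · rw [if_pos (hV hiU)]
          exact hD i
        · refine discards_of_le_one (not_lt.mp fun hlt => hi ?_) _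
          exact (hS _).mpr ⟨rfl, hiU, hlt⟩
      refine P.trace_tensor_mul_congr dS dX
        (fun s hs => mem_portsAt_procSrc_none.mpr ((hS s).mp hs).1) j ?_
        (hdis _ (Finset.Subset.refl _)) (hdis _ (Finset.erase_subset _ _)) ?_ ?_
      · intro hsig
        obtain ⟨s, hs, hp⟩ := hns j hdj S (fun s hs => ((hS s).mp hs).1)
          (fun s hs => ((hS s).mp hs).2.2) hsig
        refine ((hS s).mp hs).2.1 (Finset.mem_erase.mpr ⟨fun e => ?_, hU j hjU _ hp⟩)
        exact irrefl j (by rwa [e] at hp)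
      · intro i hi
        simp [hi]
      · intro a a'
        simp [hjU, hC j hjU, hD']
    · congr 3
      funext i
      by_cases hi : i = j
      · subst hi
        simp only [Finset.notMem_erase, if_false, hjU, if_true]
        have : Subsingleton (Fin (P.dO i)) := Fin.subsingleton_iff_le_one.mpr hdj
        -- With a one-dimensional output the Choi matrix equals its own output trace, so trace
        -- preservation determines it.
        have key : ∀ E : Matrix (Fin (P.dI i) × Fin (P.dO i)) (Fin (P.dI i) × Fin (P.dO i)) ℂ,
            ∀ p q, E p q = ∑ b, E (p.1, b) (q.1, b) := by
          intro E p q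
          rw [Fintype.sum_subsingleton _ p.2]
          exact congrArg (E p) (Prod.ext rfl (Subsingleton.elim _ _))
        ext p q
        rw [key (C i), key (D i), hC i hjU, hD']
      · simp [hi]

theorem isFixedOrder_of_signals (dS dX : Fin N → ℕ) {prec : Fin N → Fin N → Prop}
    (irrefl : ∀ i, ¬ prec i i) (trans : ∀ i j k, prec i j → prec j k → prec i k)
    (hns : ∀ j, 1 < P.dO j → ∀ S : Finset (Fin N × Port), (∀ s ∈ S, s.2 = Port.inp) →
      (∀ s ∈ S, 1 < P.dI s.1) → Signals (P.map dS dX) {(j, Port.out)} S →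
        ∃ s ∈ S, prec j s.1) : P.IsFixedOrder := by
  classical
  refine ⟨prec, irrefl, trans, ?_⟩
  intro A X _ _ J K a a' haa x
  -- The parties outside `K` and its past, whose settings must drop out; transitivity makes this set
  -- up-closed.
  let U : Finset (Fin N) := Finset.univ.filter fun j => ¬ (j ∈ K ∨ ∃ k ∈ K, prec j k)
  have hU : ∀ j, j ∈ U ↔ ¬ (j ∈ K ∨ ∃ k ∈ K, prec j k) := by simp [U]
  have up : ∀ i ∈ U, ∀ j, prec i j → j ∈ U := by
    intro i hi j hij
    rw [hU] at hi ⊢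
    rintro (hj | ⟨k, hk, hjk⟩)
    · exact hi (.inr ⟨j, hj, hij⟩)
    · exact hi (.inr ⟨k, hk, trans _ _ _ hij hjk⟩)
  have tp : ∀ (a : ∀ i, A i), ∀ i ∈ U, ∀ b b', ∑ c, choi (if i ∈ K then (J i).op (a i) (x i)
      else ∑ x', (J i).op (a i) x') (b, c) (b', c) = if b = b' then 1 else 0 := by
    intro a i hi
    rw [if_neg fun h => (hU i).mp hi (.inl h)]
    exact sum_choi_of_isTP ((J i).tp (a i))
  have hD := fun i => discards_choi_tracePrepare (m := P.dI i) (⟨0, P.dO_pos i⟩ : Fin (P.dO i))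
  have hD' := fun i => sum_choi_of_isTP
    (isTP_tracePrepare (X := Fin (P.dI i)) (⟨0, P.dO_pos i⟩ : Fin (P.dO i)))
  rw [marginal_eq, marginal_eq,
    P.trace_tensor_mul_replace dS dX irrefl trans hns hD hD' _ U up (tp a),
    P.trace_tensor_mul_replace dS dX irrefl trans hns hD hD' _ U up (tp a')]
  congr 3
  funext i
  by_cases hi : i ∈ U
  · simp only [hi, if_true]
  · simp only [hi, if_false]
    rw [haa i (not_not.mp fun h => hi ((hU i).mpr h))]

/-! ### Causal paths in the process network -/

theorem exists_path_of_signals {L : P.Labs} {T : Type*} [PartialOrder T]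
    (R : SpacetimeRealisation (P.network L) T) (hR : R.RelativisticCausality)
    (b : Option (Fin N)) {S₁ S₂ : Finset (Fin N × Port)} (hd : Disjoint S₁ S₂)
    (h : Signals ((P.network L).map b) S₁ S₂) :
    ∃ s₁ ∈ S₁, ∃ s₂ ∈ S₂,
      Relation.TransGen (regionGraph (Set.range R.emb)) (R.emb s₁) (R.emb s₂) :=
  R.exists_path hR hd ((P.network L).sig_of_signals_map b h)

theorem exists_path_lab {L : P.Labs} (hL : L.Transmitting) {T : Type*} [PartialOrder T]
    (R : SpacetimeRealisation (P.network L) T) (hR : R.RelativisticCausality) {i : Fin N}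
    (hI : 1 < P.dI i) (hO : 1 < P.dO i) :
    Relation.TransGen (regionGraph (Set.range R.emb)) (R.emb (i, Port.inp))
      (R.emb (i, Port.out)) := by
  have hd : Disjoint ({(i, Port.inp)} : Finset (Fin N × Port)) {(i, Port.out)} := by simp
  obtain ⟨s, hs, t, ht, hst⟩ := P.exists_path_of_signals R hR (some i) hd (hL i hI hO)
  rwa [Finset.mem_singleton.mp hs, Finset.mem_singleton.mp ht] at hst

end ProcessMatrix

end QST

theorem theorem1 {N : ℕ} (P : QST.ProcessMatrix N) (L : P.Labs) (hL : L.Transmitting)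
    {T : Type*} [PartialOrder T] (R : QST.SpacetimeRealisation (P.network L) T) :
    ¬ (¬ P.IsFixedOrder ∧ R.RelativisticCausality ∧ R.AcyclicImage) := by
  rintro ⟨hW, hR, hacyc⟩
  let before : Fin N × QST.Port → Fin N × QST.Port → Prop := fun s t =>
    Relation.TransGen (QST.regionGraph (Set.range R.emb)) (R.emb s) (R.emb t)
  -- The dimension conditions ensure that a party with an incoming and an outgoing edge has a
  -- transmitting laboratory, which links its input region to its output region.
  let edge : Fin N → Fin N → Prop := fun i j =>
    1 < P.dO i ∧ 1 < P.dI j ∧ before (i, .out) (j, .inp)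
  have path : ∀ {i j}, Relation.TransGen edge i j →
      1 < P.dO i ∧ 1 < P.dI j ∧ before (i, .out) (j, .inp) := by
    intro i j h
    induction h with
    | single e => exact e
    | @tail k l _ e ih =>
      obtain ⟨hi, hk, h₁⟩ := ih
      obtain ⟨hk', hl, h₂⟩ := e
      exact ⟨hi, hl, h₁.trans ((P.exists_path_lab hL R hR hk hk').trans h₂)⟩
  refine hW (P.isFixedOrder_of_signals L.dS L.dX (prec := Relation.TransGen edge) ?_
    (fun _ _ _ => Relation.TransGen.trans) ?_)
  · intro i h
    obtain ⟨hi, hi', h₁⟩ := path h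
    -- A party preceding itself has both systems non-trivial, so its own laboratory closes the path
    -- into a cycle of regions.
    exact hacyc _ (h₁.trans (P.exists_path_lab hL R hR hi' hi))
  · intro j hj S hS hdim hsig
    have hd : Disjoint {(j, QST.Port.out)} S :=
      Finset.disjoint_singleton_left.mpr fun h => by cases hS _ h
    obtain ⟨s, hs, ⟨k, p⟩, ht, hst⟩ := P.exists_path_of_signals R hR none hd hsig
    obtain rfl := Finset.mem_singleton.mp hs
    obtain rfl : p = .inp := hS _ ht
    exact ⟨(k, .inp), ht, .single ⟨hj, hdim _ ht, hst⟩⟩
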